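/- Let $\theta\in\mathbb R$ and $R_\theta=\begin{pmatrix}\cos\theta&-\sin\theta\\ \sin\theta&\cos\theta\end{pmatrix}$. In one round of the position-verification protocol $\mathrm{QPV}_\theta$, the verifiers choose independent uniformly random bits $x,b\in\{0,1\}$, prepare the qubit $(R_\theta)^b|x\rangle$, and expect the answer $x$. For $d\ge 1$, an attack with a maximally entangled pair of qudits of dimension $d$ is given by the following data. 1. A pure state $|\Phi\rangle\in\mathbb C^d\otimes\mathbb C^d$ whose reduced state is maximally mixed, shared by Alice and Bob. 2. A unitary $V'$ on $\mathbb C^2\otimes\mathbb C^d$. Alice, who does not know $b$, applies it to the verifiers' qubit and her half of $|\Phi\rangle$, then measures both systems in the computational basis, with one of $2d$ outcomes $u$. 3. Unitaries $W_0,W_1$ on $\mathbb C^d$. Bob, who knows $b$, applies $W_b$ to his half of $|\Phi\rangle$ and then measures it in the computational basis, with one of $d$ outcomes $s$. 4. A function $f$. After exchanging $b,s,u$, both attackers answer $f(b,s,u)\in\{0,1\}$. The attackers *can perfectly break $\mathrm{QPV}_\theta$ in dimension $d$* if some such attack answers $x$ correctly with probability $1$. For unitaries $U$ on $\mathbb C^d$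 and $V$ on $\mathbb C^2\otimes\mathbb C^d$ put $|\psi_b(x,s)\rangle=V(R_\theta\otimes U)^b(|x\rangle\otimes|s\rangle)$. The pair $(U,V)$ satisfies the *deterministic distinguishability condition* (DDC) for $\theta$ if, for all $u$, $s$ and $b$, $\langle u|\psi_b(0,s)\rangle=0$ or $\langle u|\psi_b(1,s)\rangle=0$. **Theorem.** For every $\theta\in\mathbb R$: - for every $d\ge1$, the attackers can perfectly break $\mathrm{QPV}_\theta$ in dimension $d$ if and only if there are unitaries $U,V$ that satisfy the DDC for $\theta$; - if the attackers can perfectly break $\mathrm{QPV}_\theta$ in dimension $d=2$, then $\theta$ is an integer multiple of $\pi/4$; - if the attackers can perfectly break $\mathrm{QPV}_\theta$ in dimension $d=3$, then $\theta$ is an integer multiple of $\pi/2$, that is, the protocol is classical. -/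

import Mathlib

open scoped Kronecker

noncomputable section

namespace QPV

/-- The rotation `R_θ`, as an operator on one qubit. -/
def rotation (θ : ℝ) : Matrix (Fin 2) (Fin 2) ℂ :=
  !![(Real.cos θ : ℂ), -(Real.sin θ : ℂ); (Real.sin θ : ℂ), (Real.cos θ : ℂ)]

/-- The ket `|a⟩` of the computational basis indexed by `ι`, as a vector of amplitudes. -/
def ket {ι : Type*} [DecidableEq ι] (a : ι) : ι → ℂ := Pi.single a 1

/-- The qubit `(R_θ)^b |x⟩` prepared by the verifiers. -/
def verifierQubit (θ : ℝ) (b x : Fin 2) : Fin 2 → ℂ :=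
  (rotation θ ^ (b : ℕ)).mulVec (ket x)

/-- A pure state `∑ i j, Φ i j |i⟩|j⟩` of two qudits is maximally entangled when its reduced state
`Φ Φ†` on the first qudit is the maximally mixed state `I / d`. -/
def IsMaximallyEntangled {d : ℕ} (Φ : Matrix (Fin d) (Fin d) ℂ) : Prop :=
  Φ * Φ.conjTranspose = ((d : ℂ)⁻¹) • (1 : Matrix (Fin d) (Fin d) ℂ)

/-- A strategy of two attackers holding a maximally entangled pair of `d`-level systems.
Outcomes of Alice's measurement of the qubit and of her qudit are indexed by the `2 d` elements of
`Fin 2 × Fin d`, outcomes of Bob's measurement by `Fin d`. -/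
structure Attack (d : ℕ) where
  /-- The shared state; the first index is Alice's. -/
  Φ : Matrix (Fin d) (Fin d) ℂ
  maximallyEntangled : IsMaximallyEntangled Φ
  /-- Alice's unitary on the verifiers' qubit and her half of the pair; it does not depend on `b`. -/
  V' : Matrix.unitaryGroup (Fin 2 × Fin d) ℂ
  /-- Bob's unitary `W b` on his half of the pair. -/
  W : Fin 2 → Matrix.unitaryGroup (Fin d) ℂ
  /-- The guess `f b s u` made by both attackers after they have exchanged `b`, `s` and `u`. -/
  f : Fin 2 → Fin d → Fin 2 × Fin d → Fin 2

/-- The joint state of verifiers' qubit, Alice's qudit and Bob's qudit before the attack. -/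
def Attack.initialState {d : ℕ} (A : Attack d) (θ : ℝ) (b x : Fin 2) :
    (Fin 2 × Fin d) × Fin d → ℂ :=
  fun p => verifierQubit θ b x p.1.1 * A.Φ p.1.2 p.2

/-- The joint state after the local unitaries `V' ⊗ W b`, just before the measurements. -/
def Attack.finalState {d : ℕ} (A : Attack d) (θ : ℝ) (b x : Fin 2) :
    (Fin 2 × Fin d) × Fin d → ℂ :=
  ((A.V' : Matrix (Fin 2 × Fin d) (Fin 2 × Fin d) ℂ) ⊗ₖ
    (A.W b : Matrix (Fin d) (Fin d) ℂ)).mulVec (A.initialState θ b x)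

/-- The probability of the outcomes `u` for Alice and `s` for Bob, given `b` and `x`. -/
def Attack.outcomeProb {d : ℕ} (A : Attack d) (θ : ℝ) (b x : Fin 2)
    (u : Fin 2 × Fin d) (s : Fin d) : ℝ :=
  ‖A.finalState θ b x (u, s)‖ ^ 2

/-- The probability that the attackers answer `x` correctly in one round, for uniform independent
bits `b` and `x`. -/
def Attack.successProb {d : ℕ} (A : Attack d) (θ : ℝ) : ℝ :=
  (1 / 4) * ∑ b : Fin 2, ∑ x : Fin 2, ∑ u : Fin 2 × Fin d, ∑ s : Fin d,
    if A.f b s u = x then A.outcomeProb θ b x u s else 0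

/-- Attackers sharing a maximally entangled pair of `d`-level systems can perfectly break the
protocol with angle `θ`. -/
def PerfectlyBreakable (d : ℕ) (θ : ℝ) : Prop :=
  ∃ A : Attack d, A.successProb θ = 1

/-- The output state `|ψ_b(x,s)⟩ = V (R_θ ⊗ U)^b (|x⟩ ⊗ |s⟩)` of the reduced circuit. -/
def psi {d : ℕ} (θ : ℝ) (U : Matrix.unitaryGroup (Fin d) ℂ)
    (V : Matrix.unitaryGroup (Fin 2 × Fin d) ℂ) (b x : Fin 2) (s : Fin d) :
    Fin 2 × Fin d → ℂ :=
  (V : Matrix (Fin 2 × Fin d) (Fin 2 × Fin d) ℂ).mulVec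
    (((rotation θ ⊗ₖ (U : Matrix (Fin d) (Fin d) ℂ)) ^ (b : ℕ)).mulVec (ket (x, s)))

/-- The deterministic distinguishability condition for the pair `(U, V)`. -/
def DDC {d : ℕ} (θ : ℝ) (U : Matrix.unitaryGroup (Fin d) ℂ)
    (V : Matrix.unitaryGroup (Fin 2 × Fin d) ℂ) : Prop :=
  ∀ (u : Fin 2 × Fin d) (s : Fin d) (b : Fin 2),
    psi θ U V b 0 s u = 0 ∨ psi θ U V b 1 s u = 0

end QPV

end

namespace QPV

open Matrix

/-! A maximally entangled state is a unitary matrix divided by `√d`, so Bob's operations can be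
moved onto Alice's side. The attack becomes one circuit, and success with probability 1 says exactly
that no outcome has nonzero amplitude for both values of `x`: this is the DDC.

For the angles, split each row of `V` into halves `a u`, `b u`. The DDC says that these have
disjoint supports, and still do after rotation by `θ` and multiplication by `U`. If `cos θ` and `sin
θ` are nonzero, both halves have squared norm 1/2 (`sum_norm_sq`).

For `d = 2` each half has one nonzero entry; comparing two rows with the columns of `U` forces `cos²
θ = sin² θ`. For `d = 3` one half of each row has a single nonzero entry. Its half and position
determine the row (`suppAt_injective`), so all six possibilities occur among the six rows, against
`exists_forall_not_suppAt`. -/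

/-- The function `x` is nonzero at `j` and only there. -/
def SuppAt {κ : Type*} (x : κ → ℂ) (j : κ) : Prop :=
  x j ≠ 0 ∧ ∀ m, m ≠ j → x m = 0

theorem SuppAt.eq {κ : Type*} {x : κ → ℂ} {j k : κ} (h : SuppAt x j) (hk : x k ≠ 0) : k = j := by
  by_contra hne
  exact hk (h.2 k hne)

theorem sum_fin_three {M : Type*} [AddCommMonoid M] {i k l : Fin 3} (hik : i ≠ k) (hil : i ≠ l)
    (hkl : k ≠ l) (f : Fin 3 → M) : ∑ m, f m = f i + f k + f l := by
  have h : (Finset.univ : Finset (Fin 3)) = {i, k, l} := by decide +revert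
  rw [h, Finset.sum_insert (by simp [hik, hil]), Finset.sum_insert (by simp [hkl]),
    Finset.sum_singleton, add_assoc]

theorem fin_three_cover {i k l : Fin 3} (hik : i ≠ k) (hil : i ≠ l) (hkl : k ≠ l) (m : Fin 3) :
    m = i ∨ m = k ∨ m = l := by
  decide +revert

theorem exists_third (i k : Fin 3) (hik : i ≠ k) : ∃ l, i ≠ l ∧ k ≠ l := by
  decide +revert

theorem suppAt_fin_three {x : Fin 3 → ℂ} {i k l : Fin 3} (hik : i ≠ k) (hil : i ≠ l)
    (hkl : k ≠ l) (hi : x i ≠ 0) (hk : x k = 0) (hl : x l = 0) : SuppAt x i := by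
  refine ⟨hi, fun m hm => ?_⟩
  rcases fin_three_cover hik hil hkl m with rfl | rfl | rfl
  · exact absurd rfl hm
  · exact hk
  · exact hl

theorem exists_suppAt_fin_two {x y : Fin 2 → ℂ} (h : ∀ j, x j = 0 ∨ y j = 0) (hx : x ≠ 0)
    (hy : y ≠ 0) : ∃ j, SuppAt x j := by
  obtain ⟨j, hj⟩ := Function.ne_iff.1 hx
  obtain ⟨k, hk⟩ := Function.ne_iff.1 hy
  refine ⟨j, hj, fun m hm => ?_⟩
  have hkj : k ≠ j := by
    rintro rfl
    exact (h k).elim hj hk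
  obtain rfl : m = k := by omega
  exact (h m).resolve_right hk

theorem exists_suppAt_fin_three {x y : Fin 3 → ℂ} (h : ∀ j, x j = 0 ∨ y j = 0) (hx : x ≠ 0)
    (hy : y ≠ 0) : ∃ j, SuppAt x j ∨ SuppAt y j := by
  obtain ⟨j, hj⟩ := Function.ne_iff.1 hx
  obtain ⟨k, hk⟩ := Function.ne_iff.1 hy
  have hkj : j ≠ k := by
    rintro rfl
    exact (h j).elim hj hk
  obtain ⟨l, hjl, hkl⟩ : ∃ l, j ≠ l ∧ k ≠ l := exists_third j k hkj
  have hyj := (h j).resolve_left hj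
  have hxk := (h k).resolve_right hk
  rcases h l with hl | hl
  · exact ⟨j, .inl (suppAt_fin_three hkj hjl hkl hj hxk hl)⟩
  · exact ⟨k, .inr (suppAt_fin_three hkj.symm hkl hjl hk hyj hl)⟩

/-! ### Unitary matrices and the two halves of the rows of `V` -/

theorem sum_norm_sq_col {κ : Type*} [Fintype κ] [DecidableEq κ] (M : unitaryGroup κ ℂ) (j : κ) :
    ∑ u, ‖(M : Matrix κ κ ℂ) u j‖ ^ 2 = 1 := by
  have h := congrFun (congrFun (mem_unitaryGroup_iff'.1 M.2) j) j
  simp only [mul_apply, star_apply, one_apply_eq, RCLike.star_def, Complex.conj_mul'] at h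
  exact_mod_cast h

theorem sum_norm_sq_row {κ : Type*} [Fintype κ] [DecidableEq κ] (M : unitaryGroup κ ℂ) (j : κ) :
    ∑ u, ‖(M : Matrix κ κ ℂ) j u‖ ^ 2 = 1 := by
  have h := congrFun (congrFun (mem_unitaryGroup_iff.1 M.2) j) j
  simp only [mul_apply, star_apply, one_apply_eq, RCLike.star_def, Complex.mul_conj'] at h
  exact_mod_cast h

/-- The rows `(a u, b u)` of the unitary `V` of a pair `(U, V)` which satisfies the deterministic
distinguishability condition, with `c = cos θ` and `s = sin θ`. -/
structure DDCRows {ι κ : Type*} [Fintype ι] [Fintype κ] [DecidableEq κ] (c s : ℝ)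
    (U : unitaryGroup κ ℂ) (a b : ι → κ → ℂ) : Prop where
  disj : ∀ u i, a u i = 0 ∨ b u i = 0
  disj_rot : ∀ u j, (((c : ℂ) • a u + (s : ℂ) • b u) ᵥ* (U : Matrix κ κ ℂ)) j = 0 ∨
    ((-(s : ℂ) • a u + (c : ℂ) • b u) ᵥ* (U : Matrix κ κ ℂ)) j = 0
  row : ∀ u, ∑ i, ‖a u i‖ ^ 2 + ∑ i, ‖b u i‖ ^ 2 = 1
  row_orth : ∀ u v, u ≠ v → ∑ i, (a u i * star (a v i) + b u i * star (b v i)) = 0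
  col_left : ∀ i, ∑ u, ‖a u i‖ ^ 2 = 1
  col_right : ∀ i, ∑ u, ‖b u i‖ ^ 2 = 1

theorem eq_of_suppAt_vecMul {κ : Type*} [Fintype κ] [DecidableEq κ] (U : unitaryGroup κ ℂ)
    {P : κ → ℂ} {j : κ} (h : SuppAt (P ᵥ* (U : Matrix κ κ ℂ)) j) (i : κ) :
    P i = (P ᵥ* (U : Matrix κ κ ℂ)) j * star ((U : Matrix κ κ ℂ) i j) := by
  have h1 : (P ᵥ* (U : Matrix κ κ ℂ)) ᵥ* star (U : Matrix κ κ ℂ) = P := by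
    rw [vecMul_vecMul, mem_unitaryGroup_iff.1 U.2, vecMul_one]
  conv_lhs => rw [← h1]
  rw [vecMul, dotProduct, Finset.sum_eq_single j]
  · rfl
  · intro m _ hm
    rw [h.2 m hm, zero_mul]
  · simp

theorem vecMul_unitary_ne_zero {κ : Type*} [Fintype κ] [DecidableEq κ] (U : unitaryGroup κ ℂ)
    {P : κ → ℂ} (h : P ≠ 0) : P ᵥ* (U : Matrix κ κ ℂ) ≠ 0 := by
  intro h0
  apply h
  have h1 : (P ᵥ* (U : Matrix κ κ ℂ)) ᵥ* star (U : Matrix κ κ ℂ) = P := by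
    rw [vecMul_vecMul, mem_unitaryGroup_iff.1 U.2, vecMul_one]
  rw [← h1, h0, zero_vecMul]

theorem col_ne_zero_iff_of_suppAt {κ : Type*} [Fintype κ] [DecidableEq κ] (U : unitaryGroup κ ℂ)
    {P : κ → ℂ} {j : κ} (h : SuppAt (P ᵥ* (U : Matrix κ κ ℂ)) j) (i : κ) :
    (U : Matrix κ κ ℂ) i j ≠ 0 ↔ P i ≠ 0 := by
  rw [eq_of_suppAt_vecMul U h i]
  simp [h.1]

theorem col_orth {κ : Type*} [Fintype κ] [DecidableEq κ] (U : unitaryGroup κ ℂ) {j k : κ}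
    (h : j ≠ k) : ∑ m, star ((U : Matrix κ κ ℂ) m j) * (U : Matrix κ κ ℂ) m k = 0 := by
  have h1 := congrFun (congrFun (mem_unitaryGroup_iff'.1 U.2) j) k
  simpa only [mul_apply, star_apply, one_apply_ne h] using h1

namespace DDCRows

section
variable {ι κ : Type*} [Fintype ι] [Fintype κ] [DecidableEq κ] {c s : ℝ}
  {U : unitaryGroup κ ℂ} {a b : ι → κ → ℂ}

/-- A quarter turn commutes with the rotation, so facts about `a` transfer to `b`. -/
theorem swap (h : DDCRows c s U a b) : DDCRows c s U b (-a) where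
  disj u i := by simpa using (h.disj u i).symm
  disj_rot u j := by
    have h1 := (h.disj_rot u j).symm
    have e1 : (c : ℂ) • b u + (s : ℂ) • (-a) u = -(s : ℂ) • a u + (c : ℂ) • b u := by
      simp [add_comm]
    have e2 : -(s : ℂ) • b u + (c : ℂ) • (-a) u = -((c : ℂ) • a u + (s : ℂ) • b u) := by
      simp [add_comm]
    rw [e1, e2, neg_vecMul, Pi.neg_apply, neg_eq_zero]
    exact h1
  row u := by simpa [add_comm] using h.row u
  row_orth u v huv := by simpa [add_comm] using h.row_orth u v huv
  col_left := h.col_right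
  col_right i := by simpa using h.col_left i

/-- Disjoint supports make the images of `P` and `Q` under `U` orthogonal, hence `P` and `Q` too.
Since `a u` and `b u` have disjoint supports, `⟨P, Q⟩` reduces to `c s (‖b u‖² - ‖a u‖²)`. -/
theorem sum_norm_sq (h : DDCRows c s U a b) (hc : c ≠ 0) (hs : s ≠ 0) (u : ι) :
    ∑ i, ‖a u i‖ ^ 2 = 1 / 2 ∧ ∑ i, ‖b u i‖ ^ 2 = 1 / 2 := by
  set P : κ → ℂ := (c : ℂ) • a u + (s : ℂ) • b u with hP
  set Q : κ → ℂ := -(s : ℂ) • a u + (c : ℂ) • b u with hQ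
  have h1 : (P ᵥ* (U : Matrix κ κ ℂ)) ⬝ᵥ star (Q ᵥ* (U : Matrix κ κ ℂ)) = 0 := by
    refine Finset.sum_eq_zero fun j _ => ?_
    rcases h.disj_rot u j with h0 | h0
    · rw [h0, zero_mul]
    · rw [Pi.star_apply, h0, star_zero, mul_zero]
  rw [star_vecMul, dotProduct_mulVec, vecMul_vecMul, ← star_eq_conjTranspose,
    mem_unitaryGroup_iff.1 U.2, vecMul_one] at h1
  have h2 : P ⬝ᵥ star Q =
      ((c * s * (∑ i, ‖b u i‖ ^ 2 - ∑ i, ‖a u i‖ ^ 2) : ℝ) : ℂ) := by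
    rw [← Finset.sum_sub_distrib, Finset.mul_sum]
    push_cast
    refine Finset.sum_congr rfl fun i _ => ?_
    have ha : a u i * star (a u i) = (‖a u i‖ : ℂ) ^ 2 := RCLike.mul_conj _
    have hb : b u i * star (b u i) = (‖b u i‖ : ℂ) ^ 2 := RCLike.mul_conj _
    have hcs : star (c : ℂ) = c := Complex.conj_ofReal c
    have hss : star (s : ℂ) = s := Complex.conj_ofReal s
    rw [← ha, ← hb]
    simp only [hP, hQ, Pi.add_apply, Pi.smul_apply, Pi.star_apply, smul_eq_mul, star_add,
      star_mul', star_neg, hcs, hss]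
    rcases h.disj u i with h0 | h0 <;> simp only [h0, star_zero] <;> ring
  rw [h2] at h1
  have h3 : ∑ i, ‖b u i‖ ^ 2 - ∑ i, ‖a u i‖ ^ 2 = 0 := by
    have := Complex.ofReal_eq_zero.1 h1
    simpa [hc, hs] using this
  have h4 := h.row u
  constructor <;> linarith

theorem left_ne_zero (h : DDCRows c s U a b) (hc : c ≠ 0) (hs : s ≠ 0) (u : ι) : a u ≠ 0 := by
  intro h0
  have := (h.sum_norm_sq hc hs u).1
  simp [h0] at this

theorem right_ne_zero (h : DDCRows c s U a b) (hc : c ≠ 0) (hs : s ≠ 0) (u : ι) : b u ≠ 0 :=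
  h.swap.left_ne_zero hc hs u

theorem norm_sq_of_suppAt (h : DDCRows c s U a b) (hc : c ≠ 0) (hs : s ≠ 0) {u : ι} {i : κ}
    (hi : SuppAt (a u) i) : ‖a u i‖ ^ 2 = 1 / 2 := by
  rw [← (h.sum_norm_sq hc hs u).1, Finset.sum_eq_single i]
  · intro m _ hm
    simp [hi.2 m hm]
  · simp

/-- Two entries of squared norm 1/2 exhaust a unit column. -/
theorem eq_zero_of_two_suppAt (h : DDCRows c s U a b) (hc : c ≠ 0) (hs : s ≠ 0)
    {u v w : ι} {i : κ} (huv : u ≠ v) (hu : SuppAt (a u) i) (hv : SuppAt (a v) i)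
    (hwu : w ≠ u) (hwv : w ≠ v) : a w i = 0 := by
  classical
  have h1 := h.col_left i
  have h2 : ∑ x ∈ {u, v, w}, ‖a x i‖ ^ 2 ≤ ∑ x, ‖a x i‖ ^ 2 :=
    Finset.sum_le_sum_of_subset_of_nonneg (Finset.subset_univ _) fun _ _ _ => by positivity
  rw [Finset.sum_insert (by simp [huv, hwu.symm]), Finset.sum_insert (by simp [hwv.symm]),
    Finset.sum_singleton, h1, h.norm_sq_of_suppAt hc hs hu, h.norm_sq_of_suppAt hc hs hv] at h2
  have h3 : ‖a w i‖ ^ 2 = 0 := le_antisymm (by linarith) (by positivity)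
  simpa using h3

end

/-! ### Dimension three -/

section three
variable {ι : Type*} [Fintype ι] {c s : ℝ} {U : unitaryGroup (Fin 3) ℂ} {a b : ι → Fin 3 → ℂ}

/-- Both rotated halves have support `{i, k}`, and `U` sends one of them to a multiple of a basis
vector; that half is then proportional to a conjugated column of `U`. -/
theorem exists_col (h : DDCRows c s U a b) (hc : c ≠ 0) (hs : s ≠ 0) {u : ι} {i k : Fin 3}
    (hik : i ≠ k) (ha : SuppAt (a u) i) (hb : SuppAt (b u) k) :
    ∃ j, ∀ l, (U : Matrix (Fin 3) (Fin 3) ℂ) l j ≠ 0 ↔ (l = i ∨ l = k) := by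
  set P : Fin 3 → ℂ := (c : ℂ) • a u + (s : ℂ) • b u with hP
  set Q : Fin 3 → ℂ := -(s : ℂ) • a u + (c : ℂ) • b u with hQ
  have hc' : (c : ℂ) ≠ 0 := by exact_mod_cast hc
  have hs' : (s : ℂ) ≠ 0 := by exact_mod_cast hs
  have hPl : ∀ l, P l ≠ 0 ↔ (l = i ∨ l = k) := by
    intro l
    rcases eq_or_ne l i with rfl | hli
    · simp [hP, hb.2 l hik, hc', ha.1]
    rcases eq_or_ne l k with rfl | hlk
    · simp [hP, ha.2 l hli, hs', hb.1]
    · simp [hP, ha.2 l hli, hb.2 l hlk, hli, hlk]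
  have hQl : ∀ l, Q l ≠ 0 ↔ (l = i ∨ l = k) := by
    intro l
    rcases eq_or_ne l i with rfl | hli
    · simp [hQ, hb.2 l hik, hs', ha.1]
    rcases eq_or_ne l k with rfl | hlk
    · simp [hQ, ha.2 l hli, hc', hb.1]
    · simp [hQ, ha.2 l hli, hb.2 l hlk, hli, hlk]
  have hP0 : P ≠ 0 := fun h0 => (hPl i).2 (.inl rfl) (congrFun h0 i)
  have hQ0 : Q ≠ 0 := fun h0 => (hQl i).2 (.inl rfl) (congrFun h0 i)
  obtain ⟨j, hj | hj⟩ := exists_suppAt_fin_three (h.disj_rot u) (vecMul_unitary_ne_zero U hP0)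
    (vecMul_unitary_ne_zero U hQ0)
  · exact ⟨j, fun l => (col_ne_zero_iff_of_suppAt U hj l).trans (hPl l)⟩
  · exact ⟨j, fun l => (col_ne_zero_iff_of_suppAt U hj l).trans (hQl l)⟩

/-- Two columns of `U` with supports `{i, k}` and `{k, l}` meet in one place, so they cannot be
orthogonal. -/
theorem false_of_overlap (h : DDCRows c s U a b) (hc : c ≠ 0) (hs : s ≠ 0) {u v : ι}
    {i k l : Fin 3} (hik : i ≠ k) (hil : i ≠ l) (hkl : k ≠ l) (hau : SuppAt (a u) i)
    (hbu : SuppAt (b u) k) (hav : SuppAt (a v) k) (hbv : SuppAt (b v) l) : False := by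
  obtain ⟨j, hj⟩ := h.exists_col hc hs hik hau hbu
  obtain ⟨j', hj'⟩ := h.exists_col hc hs hkl hav hbv
  have hi' : (U : Matrix (Fin 3) (Fin 3) ℂ) i j' = 0 := by
    simpa [hik, hil] using hj' i
  have hl' : (U : Matrix (Fin 3) (Fin 3) ℂ) l j = 0 := by
    simpa [hil.symm, hkl.symm] using hj l
  have hne : j ≠ j' := by
    rintro rfl
    exact (hj i).2 (.inl rfl) hi'
  have h0 := col_orth U hne
  rw [sum_fin_three hik hil hkl, hi', hl'] at h0
  have hk := (hj k).2 (.inr rfl)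
  have hk' := (hj' k).2 (.inl rfl)
  simp [hk, hk'] at h0

/-- The `a` halves are pairwise orthogonal, so the `b` halves are too; any two of these can overlap
in only one position. Starting from `b u k ≠ 0`, orthogonality fixes the supports of `b w`, `b v`,
`b u` in turn. -/
theorem false_of_cycle (h : DDCRows c s U a b) (hc : c ≠ 0) (hs : s ≠ 0) {u v w : ι}
    {i k l : Fin 3} (hik : i ≠ k) (hil : i ≠ l) (hkl : k ≠ l) (hu : SuppAt (a u) i)
    (hv : SuppAt (a v) k) (hw : SuppAt (a w) l) (hbk : b u k ≠ 0) : False := by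
  have orth : ∀ {p q : ι} {x y z : Fin 3}, x ≠ y → x ≠ z → y ≠ z → SuppAt (a p) x →
      SuppAt (a q) y → b p z ≠ 0 → b q z = 0 := by
    intro p q x y z hxy hxz hyz hp hq hpz
    have hpq : p ≠ q := by
      rintro rfl
      exact hxy (hq.eq hp.1)
    have h0 := h.row_orth p q hpq
    rw [sum_fin_three hxy hxz hyz, hp.2 y hxy.symm, hp.2 z hxz.symm, hq.2 x hxy,
      (h.disj p x).resolve_left hp.1, (h.disj q y).resolve_left hq.1] at h0
    simpa [hpz] using h0
  have nz : ∀ {q : ι} {x y z : Fin 3}, x ≠ y → x ≠ z → y ≠ z → SuppAt (a q) x →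
      b q y = 0 → SuppAt (b q) z := by
    intro q x y z hxy hxz hyz hq hy
    have hx := (h.disj q x).resolve_left hq.1
    refine suppAt_fin_three hxz.symm hyz.symm hxy (fun hz => h.right_ne_zero hc hs q ?_) hx hy
    funext m
    rcases fin_three_cover hxy hxz hyz m with rfl | rfl | rfl <;> assumption
  have hbw : SuppAt (b w) i :=
    nz hkl.symm hil.symm hik.symm hw (orth hil hik hkl.symm hu hw hbk)
  have hbv : SuppAt (b v) l :=
    nz hik.symm hkl hil hv (orth hkl.symm hil.symm hik.symm hw hv hbw.1)
  have hbu : SuppAt (b u) k :=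
    nz hil hik hkl.symm hu (orth hik.symm hkl hil hv hu hbv.1)
  exact h.false_of_overlap hc hs hik hil hkl hu hbu hv hbv

theorem exists_forall_not_suppAt (h : DDCRows c s U a b) (hc : c ≠ 0) (hs : s ≠ 0) :
    ∃ k, ∀ u, ¬ SuppAt (a u) k := by
  by_contra! hall
  obtain ⟨u, hu⟩ := hall 0
  obtain ⟨v, hv⟩ := hall 1
  obtain ⟨w, hw⟩ := hall 2
  obtain ⟨m, hm⟩ := Function.ne_iff.1 (h.right_ne_zero hc hs u)
  have hm0 : m ≠ 0 := by
    rintro rfl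
    exact (h.disj u 0).elim hu.1 hm
  rcases (by omega : m = 1 ∨ m = 2) with rfl | rfl
  · exact h.false_of_cycle hc hs (by decide) (by decide) (by decide) hu hv hw hm
  · exact h.false_of_cycle hc hs (by decide) (by decide) (by decide) hu hw hv hm

theorem suppAt_injective (h : DDCRows c s U a b) (hc : c ≠ 0) (hs : s ≠ 0) {u v : ι} {i : Fin 3}
    (hu : SuppAt (a u) i) (hv : SuppAt (a v) i) : u = v := by
  by_contra huv
  obtain ⟨k, hk⟩ := h.exists_forall_not_suppAt hc hs
  have hik : i ≠ k := by
    rintro rfl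
    exact hk u hu
  obtain ⟨l, hil, hkl⟩ : ∃ l, i ≠ l ∧ k ≠ l := exists_third i k hik
  -- Rows `u` and `v` exhaust column `i` of `a`, and `k` is never a sole support. So `a x` lives
  -- exactly on `k, l`, and `b x` only on `i`. Summing over `x` compares two unit columns strictly.
  have key : ∀ x, a x k ≠ 0 → ‖a x k‖ ^ 2 < ‖b x i‖ ^ 2 := by
    intro x hx
    have hxu : x ≠ u := by
      rintro rfl
      exact hik (hu.eq hx).symm
    have hxv : x ≠ v := by
      rintro rfl
      exact hik (hv.eq hx).symm
    have hxi : a x i = 0 := h.eq_zero_of_two_suppAt hc hs huv hu hv hxu hxv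
    have hxl : a x l ≠ 0 := fun h0 => hk x (suppAt_fin_three hkl hik.symm hil.symm hx h0 hxi)
    have hbk := (h.disj x k).resolve_left hx
    have hbl := (h.disj x l).resolve_left hxl
    obtain ⟨h1, h2⟩ := h.sum_norm_sq hc hs x
    rw [sum_fin_three hik hil hkl] at h1 h2
    simp only [hxi, hbk, hbl, norm_zero] at h1 h2
    have h3 : 0 < ‖a x l‖ ^ 2 := by positivity
    linarith
  obtain ⟨x, hx⟩ : ∃ x, a x k ≠ 0 := by
    by_contra! h0
    have := h.col_left k
    simp [h0] at this
  have hlt : ∑ x, ‖a x k‖ ^ 2 < ∑ x, ‖b x i‖ ^ 2 := by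
    refine Finset.sum_lt_sum (fun y _ => ?_) ⟨x, Finset.mem_univ _, key x hx⟩
    rcases eq_or_ne (a y k) 0 with h0 | h0
    · rw [h0, norm_zero, zero_pow two_ne_zero]
      positivity
    · exact (key y h0).le
  rw [h.col_left, h.col_right] at hlt
  exact lt_irrefl _ hlt

end three

theorem false_of_fin_three {c s : ℝ} {U : unitaryGroup (Fin 3) ℂ}
    {a b : Fin 2 × Fin 3 → Fin 3 → ℂ} (h : DDCRows c s U a b) (hc : c ≠ 0) (hs : s ≠ 0) :
    False := by
  have hex : ∀ u, ∃ p : Fin 2 × Fin 3, (p.1 = 0 → SuppAt (a u) p.2) ∧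
      (p.1 = 1 → SuppAt (b u) p.2) := by
    intro u
    obtain ⟨j, hj | hj⟩ := exists_suppAt_fin_three (h.disj u) (h.left_ne_zero hc hs u)
      (h.right_ne_zero hc hs u)
    · exact ⟨(0, j), fun _ => hj, fun h0 => absurd h0 zero_ne_one⟩
    · exact ⟨(1, j), fun h0 => absurd h0 one_ne_zero, fun _ => hj⟩
  choose F hF0 hF1 using hex
  have hinj : Function.Injective F := by
    intro u v huv
    rcases (by omega : (F u).1 = 0 ∨ (F u).1 = 1) with h0 | h0
    · exact h.suppAt_injective hc hs (hF0 u h0) (huv ▸ hF0 v (huv ▸ h0))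
    · exact h.swap.suppAt_injective hc hs (hF1 u h0) (huv ▸ hF1 v (huv ▸ h0))
  obtain ⟨k, hk⟩ := h.exists_forall_not_suppAt hc hs
  obtain ⟨u, hu⟩ := Finite.injective_iff_surjective.1 hinj (0, k)
  have := hF0 u (by rw [hu])
  rw [hu] at this
  exact hk u this

/-! ### Dimension two -/

theorem sq_eq_sq_of_fin_two {ι : Type*} [Fintype ι] {c s : ℝ} {U : unitaryGroup (Fin 2) ℂ}
    {a b : ι → Fin 2 → ℂ} (h : DDCRows c s U a b) (hc : c ≠ 0) (hs : s ≠ 0) : c ^ 2 = s ^ 2 := by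
  have hc' : (c : ℂ) ≠ 0 := by exact_mod_cast hc
  have hs' : (s : ℂ) ≠ 0 := by exact_mod_cast hs
  have supp : ∀ u, a u 0 ≠ 0 → a u 1 = 0 ∧ b u 0 = 0 ∧ b u 1 ≠ 0 := by
    intro u hu
    have h0 := (h.disj u 0).resolve_left hu
    have h1 : b u 1 ≠ 0 := fun h1 => h.right_ne_zero hc hs u (by
      funext m
      fin_cases m <;> assumption)
    exact ⟨(h.disj u 1).resolve_right h1, h0, h1⟩
  have half : ∀ u, a u 0 ≠ 0 → ‖a u 0‖ ^ 2 = 1 / 2 := by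
    intro u hu
    have := (h.sum_norm_sq hc hs u).1
    simpa [(supp u hu).1] using this
  -- Nonzero entries contribute 1/2 each to a column of total 1.
  obtain ⟨u, v, huv, hu, hv⟩ : ∃ u v, u ≠ v ∧ a u 0 ≠ 0 ∧ a v 0 ≠ 0 := by
    by_contra! h0
    have h1 := h.col_left 0
    by_cases hex : ∃ u, a u 0 ≠ 0
    · obtain ⟨u, hu⟩ := hex
      rw [Finset.sum_eq_single u (fun v _ hv => by simp [h0 u v hv.symm hu]) (by simp),
        half u hu] at h1
      norm_num at h1
    · push Not at hex
      simp [hex] at h1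
  obtain ⟨hu1, hu0, hub⟩ := supp u hu
  obtain ⟨hv1, hv0, hvb⟩ := supp v hv
  have horth := h.row_orth u v huv
  simp only [Fin.sum_univ_two, hu1, hu0, hv1, hv0, zero_mul, add_zero, zero_add] at horth
  have col : ∀ u, a u 0 ≠ 0 → ∃ j, ∃ t : ℂ, t ≠ 0 ∧
      c * a u 0 = t * star ((U : Matrix (Fin 2) (Fin 2) ℂ) 0 j) ∧
      s * b u 1 = t * star ((U : Matrix (Fin 2) (Fin 2) ℂ) 1 j) := by
    intro u hu
    obtain ⟨hu1, hu0, hub⟩ := supp u hu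
    have hP : (c : ℂ) • a u + (s : ℂ) • b u ≠ 0 := fun h0 => by
      have := congrFun h0 0
      simp [hu0, hc', hu] at this
    have hQ : -(s : ℂ) • a u + (c : ℂ) • b u ≠ 0 := fun h0 => by
      have := congrFun h0 0
      simp [hu0, hs', hu] at this
    obtain ⟨j, hj⟩ := exists_suppAt_fin_two (h.disj_rot u) (vecMul_unitary_ne_zero U hP)
      (vecMul_unitary_ne_zero U hQ)
    refine ⟨j, _, hj.1, ?_, ?_⟩
    · rw [← eq_of_suppAt_vecMul U hj]
      simp [hu0]
    · rw [← eq_of_suppAt_vecMul U hj]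
      simp [hu1]
  obtain ⟨j, t, ht, e0, e1⟩ := col u hu
  obtain ⟨k, r, hr, f0, f1⟩ := col v hv
  have hcs : star (c : ℂ) = c := Complex.conj_ofReal c
  have hss : star (s : ℂ) = s := Complex.conj_ofReal s
  have g0 := congrArg star f0
  have g1 := congrArg star f1
  simp only [star_mul', star_star, hcs, hss] at g0 g1
  -- A common column would make the rows `u` and `v` both proportional and orthogonal. Distinct
  -- columns give a second orthogonality relation, with weights `c²` and `s²`.
  by_cases hjk : j = k
  · subst hjk
    exfalso
    have h1 : a u 0 * b v 1 = a v 0 * b u 1 := by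
      apply mul_left_cancel₀ (mul_ne_zero hc' hs')
      calc (c : ℂ) * s * (a u 0 * b v 1) = (c * a u 0) * (s * b v 1) := by ring
        _ = (c * a v 0) * (s * b u 1) := by rw [e0, e1, f0, f1]; ring
        _ = _ := by ring
    have h2 : a u 0 * (a v 0 * star (a v 0) + b v 1 * star (b v 1)) = 0 := by
      linear_combination a v 0 * horth + star (b v 1) * h1
    have ha : a v 0 * star (a v 0) = (‖a v 0‖ : ℂ) ^ 2 := RCLike.mul_conj _
    have hb : b v 1 * star (b v 1) = (‖b v 1‖ : ℂ) ^ 2 := RCLike.mul_conj _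
    have h3 := (mul_eq_zero.1 h2).resolve_left hu
    rw [ha, hb] at h3
    have h4 : ‖a v 0‖ ^ 2 + ‖b v 1‖ ^ 2 = 0 := by exact_mod_cast h3
    have h5 : 0 < ‖a v 0‖ ^ 2 := by positivity
    have h6 : 0 ≤ ‖b v 1‖ ^ 2 := by positivity
    linarith
  · have h0 := col_orth U hjk
    rw [Fin.sum_univ_two] at h0
    have h1 : ((c : ℂ) ^ 2 - s ^ 2) * (a u 0 * star (a v 0)) = 0 := by
      have h2 : (c * a u 0) * (c * star (a v 0)) + (s * b u 1) * (s * star (b v 1)) = 0 := by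
        rw [e0, e1, g0, g1]
        linear_combination t * star r * h0
      linear_combination h2 - (s : ℂ) ^ 2 * horth
    have h2 := (mul_eq_zero.1 h1).resolve_right (mul_ne_zero hu (star_ne_zero.2 hv))
    exact_mod_cast sub_eq_zero.1 h2

end DDCRows

/-! ### From the DDC to the angle -/

theorem rotation_mem_unitaryGroup (θ : ℝ) : rotation θ ∈ unitaryGroup (Fin 2) ℂ := by
  have h : (Complex.cos θ) ^ 2 + (Complex.sin θ) ^ 2 = 1 := by
    rw [add_comm, Complex.sin_sq_add_cos_sq]
  rw [mem_unitaryGroup_iff]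
  ext i j
  fin_cases i <;> fin_cases j <;>
    simp [rotation, mul_apply, Fin.sum_univ_two, ← Complex.cos_conj, ← Complex.sin_conj] <;>
    first | linear_combination h | ring

theorem psi_eq {d : ℕ} (θ : ℝ) (U : unitaryGroup (Fin d) ℂ) (V : unitaryGroup (Fin 2 × Fin d) ℂ)
    (b x : Fin 2) (s : Fin d) (u : Fin 2 × Fin d) :
    psi θ U V b x s u = ((V : Matrix (Fin 2 × Fin d) (Fin 2 × Fin d) ℂ) *
      (rotation θ ⊗ₖ (U : Matrix (Fin d) (Fin d) ℂ)) ^ (b : ℕ)) u (x, s) := by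
  rw [psi, mulVec_mulVec, ket, mulVec_single_one]
  rfl

theorem DDC.rows {d : ℕ} {θ : ℝ} {U : unitaryGroup (Fin d) ℂ}
    {V : unitaryGroup (Fin 2 × Fin d) ℂ} (h : DDC θ U V) :
    DDCRows (Real.cos θ) (Real.sin θ) U
      (fun u i => (V : Matrix (Fin 2 × Fin d) (Fin 2 × Fin d) ℂ) u (0, i))
      (fun u i => (V : Matrix (Fin 2 × Fin d) (Fin 2 × Fin d) ℂ) u (1, i)) where
  disj u i := by simpa [psi_eq] using h u i 0
  disj_rot u j := by
    have h1 := h u j 1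
    simp only [psi_eq, Fin.val_one, pow_one, mul_apply, Fintype.sum_prod_type, Fin.sum_univ_two,
      kroneckerMap_apply, rotation, of_apply, cons_val', cons_val_zero, cons_val_one,
      cons_val_fin_one, ← Finset.sum_add_distrib] at h1
    simp only [vecMul, dotProduct, Pi.add_apply, Pi.smul_apply, smul_eq_mul]
    convert h1 using 4 <;> ring
  row u := by
    have h1 := sum_norm_sq_row V u
    rwa [Fintype.sum_prod_type, Fin.sum_univ_two] at h1
  row_orth u v huv := by
    have h1 := congrFun (congrFun (mem_unitaryGroup_iff.1 V.2) u) v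
    rw [one_apply_ne huv, mul_apply, Fintype.sum_prod_type, Fin.sum_univ_two,
      ← Finset.sum_add_distrib] at h1
    exact h1
  col_left i := sum_norm_sq_col V (0, i)
  col_right i := sum_norm_sq_col V (1, i)

theorem DDC.exists_int_of_two {θ : ℝ} {U : unitaryGroup (Fin 2) ℂ}
    {V : unitaryGroup (Fin 2 × Fin 2) ℂ} (h : DDC θ U V) :
    ∃ n : ℤ, θ = n * (Real.pi / 4) := by
  -- `sin 4θ = 4 sin θ cos θ (cos² θ - sin² θ)` covers all three cases.
  have h0 : Real.sin (2 * (2 * θ)) = 0 := by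
    rw [Real.sin_two_mul, Real.sin_two_mul, Real.cos_two_mul']
    by_cases hc : Real.cos θ = 0
    · simp [hc]
    by_cases hs : Real.sin θ = 0
    · simp [hs]
    · rw [h.rows.sq_eq_sq_of_fin_two hc hs, sub_self, mul_zero]
  obtain ⟨n, hn⟩ := Real.sin_eq_zero_iff.1 h0
  exact ⟨n, by linarith⟩

theorem DDC.exists_int_of_three {θ : ℝ} {U : unitaryGroup (Fin 3) ℂ}
    {V : unitaryGroup (Fin 2 × Fin 3) ℂ} (h : DDC θ U V) :
    ∃ n : ℤ, θ = n * (Real.pi / 2) := by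
  have h0 : Real.sin (2 * θ) = 0 := by
    rw [Real.sin_two_mul]
    by_cases hc : Real.cos θ = 0
    · simp [hc]
    by_cases hs : Real.sin θ = 0
    · simp [hs]
    · exact (h.rows.false_of_fin_three hc hs).elim
  obtain ⟨n, hn⟩ := Real.sin_eq_zero_iff.1 h0
  exact ⟨n, by linarith⟩

/-! ### Attacks and the DDC -/

section attack
variable {d : ℕ}

theorem coe_sqrt_mul_self (d : ℕ) : ((√(d : ℝ) : ℝ) : ℂ) * ((√(d : ℝ) : ℝ) : ℂ) = d := by
  rw [← Complex.ofReal_mul, Real.mul_self_sqrt (Nat.cast_nonneg d), Complex.ofReal_natCast]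

theorem coe_sqrt_ne_zero (hd : 0 < d) : ((√(d : ℝ) : ℝ) : ℂ) ≠ 0 := by
  rw [Complex.ofReal_ne_zero]
  positivity

/-- The shared state followed by Bob's unitary, rescaled to a unitary matrix. -/
noncomputable def Attack.bobMatrix (A : Attack d) (b : Fin 2) : Matrix (Fin d) (Fin d) ℂ :=
  ((√(d : ℝ) : ℝ) : ℂ) • (A.Φ * (A.W b : Matrix (Fin d) (Fin d) ℂ)ᵀ)

theorem Attack.bobMatrix_mem_unitaryGroup (A : Attack d) (hd : 0 < d) (b : Fin 2) :
    A.bobMatrix b ∈ unitaryGroup (Fin d) ℂ := by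
  have hW : (A.W b : Matrix (Fin d) (Fin d) ℂ)ᵀ * (A.W b : Matrix (Fin d) (Fin d) ℂ)ᵀᴴ = 1 := by
    rw [← star_eq_conjTranspose]
    exact mem_unitaryGroup_iff.1 (transpose_mem_unitaryGroup_iff.2 (A.W b).2)
  have hd' : (d : ℂ) ≠ 0 := by exact_mod_cast hd.ne'
  have hs : star ((√(d : ℝ) : ℝ) : ℂ) = ((√(d : ℝ) : ℝ) : ℂ) := Complex.conj_ofReal _
  rw [mem_unitaryGroup_iff, star_eq_conjTranspose, bobMatrix, conjTranspose_smul, hs,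
    conjTranspose_mul, smul_mul_smul_comm, coe_sqrt_mul_self, Matrix.mul_assoc,
    ← Matrix.mul_assoc _ _ A.Φᴴ, hW, Matrix.one_mul, A.maximallyEntangled, smul_smul,
    mul_inv_cancel₀ hd', one_smul]

/-- Acting by `W b` on the second factor multiplies `Φ` on the right by its transpose, so Bob's
outcome `s` acts as an input label of Alice's circuit. -/
theorem Attack.finalState_eq (A : Attack d) (hd : 0 < d) (θ : ℝ) (b x : Fin 2)
    (u : Fin 2 × Fin d) (s : Fin d) :
    A.finalState θ b x (u, s) = ((√(d : ℝ) : ℝ) : ℂ)⁻¹ *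
      ((A.V' : Matrix (Fin 2 × Fin d) (Fin 2 × Fin d) ℂ) *
        ((rotation θ ^ (b : ℕ)) ⊗ₖ A.bobMatrix b)) u (x, s) := by
  have hq : ∀ y, verifierQubit θ b x y = (rotation θ ^ (b : ℕ)) y x := fun y => by
    rw [verifierQubit, ket, mulVec_single_one]
    rfl
  rw [finalState, mulVec, dotProduct, Fintype.sum_prod_type, mul_apply, Finset.mul_sum]
  refine Finset.sum_congr rfl fun p _ => ?_
  simp only [kroneckerMap_apply, initialState, hq, bobMatrix, Matrix.smul_apply, smul_eq_mul, mul_apply,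
    transpose_apply, Finset.mul_sum]
  refine Finset.sum_congr rfl fun j _ => ?_
  have := coe_sqrt_ne_zero hd
  field_simp

theorem Attack.sum_outcomeProb (A : Attack d) (hd : 0 < d) (θ : ℝ) (b x : Fin 2) :
    ∑ u, ∑ s, A.outcomeProb θ b x u s = 1 := by
  have hM : (A.V' : Matrix (Fin 2 × Fin d) (Fin 2 × Fin d) ℂ) *
      ((rotation θ ^ (b : ℕ)) ⊗ₖ A.bobMatrix b) ∈ unitaryGroup (Fin 2 × Fin d) ℂ :=
    mul_mem A.V'.2 (kronecker_mem_unitary (pow_mem (rotation_mem_unitaryGroup θ) _)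
      (A.bobMatrix_mem_unitaryGroup hd b))
  have hd' : (d : ℝ) ≠ 0 := by positivity
  have h : ∀ s : Fin d, ∑ u, A.outcomeProb θ b x u s = (d : ℝ)⁻¹ := by
    intro s
    have h1 := sum_norm_sq_col ⟨_, hM⟩ (x, s)
    simp only [outcomeProb, A.finalState_eq hd, norm_mul, mul_pow, ← Finset.mul_sum]
    rw [h1, norm_inv, Complex.norm_of_nonneg (Real.sqrt_nonneg _), inv_pow,
      Real.sq_sqrt (Nat.cast_nonneg d), mul_one]
  rw [Finset.sum_comm]
  simp [h, hd']

theorem Attack.successProb_eq_one_iff (A : Attack d) (hd : 0 < d) (θ : ℝ) :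
    A.successProb θ = 1 ↔ ∀ b x u s, A.f b s u ≠ x → A.finalState θ b x (u, s) = 0 := by
  have hle : ∀ b x u s, (if A.f b s u = x then A.outcomeProb θ b x u s else 0) ≤
      A.outcomeProb θ b x u s := by
    intro b x u s
    split_ifs
    · exact le_rfl
    · exact sq_nonneg _
  have htot : ∑ b : Fin 2, ∑ x : Fin 2, ∑ u, ∑ s, A.outcomeProb θ b x u s = 4 := by
    simp only [A.sum_outcomeProb hd]
    norm_num
  have h1 : A.successProb θ = 1 ↔ ∑ b : Fin 2, ∑ x : Fin 2, ∑ u : Fin 2 × Fin d, ∑ s : Fin d,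
      (if A.f b s u = x then A.outcomeProb θ b x u s else 0) =
      ∑ b : Fin 2, ∑ x : Fin 2, ∑ u, ∑ s, A.outcomeProb θ b x u s := by
    rw [htot, successProb]
    constructor <;> intro h <;> linarith
  simp only [← Fintype.sum_prod_type'] at h1
  rw [h1, Finset.sum_eq_sum_iff_of_le fun _ _ => hle _ _ _ _]
  constructor
  · intro h b x u s hf
    have := h (b, x, u, s) (Finset.mem_univ _)
    rw [if_neg hf] at this
    exact norm_eq_zero.1 (pow_eq_zero_iff two_ne_zero |>.1 this.symm)
  · rintro h ⟨b, x, u, s⟩ -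
    by_cases hf : A.f b s u = x
    · simp [hf]
    · simp [hf, outcomeProb, h b x u s hf]

theorem PerfectlyBreakable.exists_ddc (hd : 0 < d) {θ : ℝ} (h : PerfectlyBreakable d θ) :
    ∃ (U : unitaryGroup (Fin d) ℂ) (V : unitaryGroup (Fin 2 × Fin d) ℂ), DDC θ U V := by
  obtain ⟨A, hA⟩ := h
  rw [A.successProb_eq_one_iff hd] at hA
  let M : Fin 2 → unitaryGroup (Fin d) ℂ := fun b => ⟨_, A.bobMatrix_mem_unitaryGroup hd b⟩
  let V : unitaryGroup (Fin 2 × Fin d) ℂ :=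
    ⟨A.V' * ((1 : Matrix (Fin 2) (Fin 2) ℂ) ⊗ₖ (M 0 : Matrix (Fin d) (Fin d) ℂ)),
      mul_mem A.V'.2 (kronecker_mem_unitary (one_mem _) (M 0).2)⟩
  -- Absorbing `M 0` into `V` normalizes the case `b = 0`; the case `b = 1` then leaves `M 0⁻¹ M 1`.
  refine ⟨star (M 0) * M 1, V, ?_⟩
  have key : ∀ b x s u, psi θ (star (M 0) * M 1) V b x s u =
      ((√(d : ℝ) : ℝ) : ℂ) * A.finalState θ b x (u, s) := by
    intro b x s u
    rw [psi_eq, A.finalState_eq hd, mul_inv_cancel_left₀ (coe_sqrt_ne_zero hd)]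
    rcases (by omega : b = 0 ∨ b = 1) with rfl | rfl
    · simp [V, M]
    · have h1 : (M 0 : Matrix (Fin d) (Fin d) ℂ) * ((star (M 0) * M 1 : unitaryGroup (Fin d) ℂ) :
          Matrix (Fin d) (Fin d) ℂ) = A.bobMatrix 1 := by
        change ((M 0 * (star (M 0) * M 1) : unitaryGroup (Fin d) ℂ) :
          Matrix (Fin d) (Fin d) ℂ) = A.bobMatrix 1
        rw [← mul_assoc, Unitary.mul_star_self, one_mul]
      simp only [V, Fin.val_one, pow_one]
      rw [Matrix.mul_assoc, ← mul_kronecker_mul, Matrix.one_mul, h1]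
  intro u s b
  rw [key, key]
  by_cases hf : A.f b s u = 0
  · right
    rw [hA b 1 u s (by simp [hf]), mul_zero]
  · left
    rw [hA b 0 u s hf, mul_zero]

theorem DDC.perfectlyBreakable (hd : 0 < d) {θ : ℝ} {U : unitaryGroup (Fin d) ℂ}
    {V : unitaryGroup (Fin 2 × Fin d) ℂ} (h : DDC θ U V) : PerfectlyBreakable d θ := by
  have hs : star (((√(d : ℝ) : ℝ) : ℂ)⁻¹) = ((√(d : ℝ) : ℝ) : ℂ)⁻¹ := by
    rw [← Complex.ofReal_inv]
    exact Complex.conj_ofReal _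
  let A : Attack d :=
    { Φ := ((√(d : ℝ) : ℝ) : ℂ)⁻¹ • 1
      maximallyEntangled := by
        rw [IsMaximallyEntangled, conjTranspose_smul, hs, conjTranspose_one, smul_mul_smul_comm,
          Matrix.one_mul, ← mul_inv, coe_sqrt_mul_self]
      V' := V
      W := fun b => ⟨((U : Matrix (Fin d) (Fin d) ℂ) ^ (b : ℕ))ᵀ,
        transpose_mem_unitaryGroup_iff.2 (pow_mem U.2 _)⟩
      -- Answer 0 unless its amplitude vanishes; the DDC makes this always correct.
      f := fun b s u => if psi θ U V b 0 s u = 0 then 1 else 0 }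
  have hB : ∀ b, A.bobMatrix b = (U : Matrix (Fin d) (Fin d) ℂ) ^ (b : ℕ) := by
    intro b
    simp only [Attack.bobMatrix, A, transpose_transpose]
    rw [smul_mul_assoc, smul_smul, mul_inv_cancel₀ (coe_sqrt_ne_zero hd), one_smul, Matrix.one_mul]
  have hpsi : ∀ b x u s, A.finalState θ b x (u, s) =
      ((√(d : ℝ) : ℝ) : ℂ)⁻¹ * psi θ U V b x s u := by
    intro b x u s
    rw [A.finalState_eq hd, hB, psi_eq]
    rcases (by omega : b = 0 ∨ b = 1) with rfl | rfl <;> simp [A]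
  refine ⟨A, (A.successProb_eq_one_iff hd θ).2 fun b x u s hf => ?_⟩
  rw [hpsi]
  by_cases h0 : psi θ U V b 0 s u = 0
  · rcases (by omega : x = 0 ∨ x = 1) with rfl | rfl
    · rw [h0, mul_zero]
    · simp [A, h0] at hf
  · rcases (by omega : x = 0 ∨ x = 1) with rfl | rfl
    · simp [A, h0] at hf
    · rw [(h u s b).resolve_left h0, mul_zero]

end attack

end QPV

theorem mainTheorem1 (θ : ℝ) :
    (∀ d : ℕ, 0 < d →
      (QPV.PerfectlyBreakable d θ ↔
        ∃ (U : Matrix.unitaryGroup (Fin d) ℂ) (V : Matrix.unitaryGroup (Fin 2 × Fin d) ℂ),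
          QPV.DDC θ U V)) ∧
    (QPV.PerfectlyBreakable 2 θ → ∃ n : ℤ, θ = n * (Real.pi / 4)) ∧
    (QPV.PerfectlyBreakable 3 θ → ∃ n : ℤ, θ = n * (Real.pi / 2)) := by
  refine ⟨fun d hd => ⟨fun h => h.exists_ddc hd, fun ⟨_, _, h⟩ => h.perfectlyBreakable hd⟩,
    fun h => ?_, fun h => ?_⟩
  · obtain ⟨_, _, h⟩ := h.exists_ddc two_pos
    exact h.exists_int_of_two
  · obtain ⟨_, _, h⟩ := h.exists_ddc three_pos
    exact h.exists_int_of_three
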